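/- Let $G$ be an uncountable abelian Polish group, i.e. an uncountable abelian topological group whose topology is separable and completely metrizable. Then there exists a set $X \subseteq G$ that is naively Haar null but not Haar null. Here Borel probability measures are identified with their completions, and a set $U \subseteq G$ is called universally measurable if it is measurable with respect to (the completion of) every Borel probability measure on $G$. A set $X \subseteq G$ is called Haar null if there exist a universally measurable set $U \supseteq X$ and a Borel probability measure $\mu$ on $G$ such that $\mu(gUh) = 0$ for all $g, h \in G$. A set $X \subseteq G$ is called naively Haar null if there exists a Borel probability measure $\mu$ on $G$ such that $\mu(gXh) = 0$ for all $g, h \in G$. -/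

import Mathlib

open MeasureTheory

/-- The two-sided translate `g X h = {g * x * h | x ∈ X}` of a subset `X` of a group. -/
def twoSidedTranslate {G : Type*} [Group G] (g : G) (X : Set G) (h : G) : Set G :=
  (fun x => g * x * h) '' X

/-- A set is universally measurable if it is measurable with respect to (the completion of)
every Borel probability measure. In Mathlib, `NullMeasurableSet U μ` says precisely that `U`
belongs to the completion of the σ-algebra with respect to `μ`. -/
def UniversallyMeasurable {G : Type*} [MeasurableSpace G] (U : Set G) : Prop :=
  ∀ μ : Measure G, IsProbabilityMeasure μ → NullMeasurableSet U μ

/-- `X` is Haar null if it has a universally measurable hull `U` all of whose two-sided translates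
have measure zero for one Borel probability measure `μ`. -/
def HaarNull {G : Type*} [Group G] [MeasurableSpace G] (X : Set G) : Prop :=
  ∃ U : Set G, X ⊆ U ∧ UniversallyMeasurable U ∧
    ∃ μ : Measure G, IsProbabilityMeasure μ ∧ ∀ g h : G, μ (twoSidedTranslate g U h) = 0

/-- `X` is naively Haar null if all two-sided translates of `X` itself have measure zero for one
Borel probability measure `μ`. Here `X` is arbitrary: a Mathlib measure is evaluated on any set as
the induced outer measure, which is zero exactly on the null sets of the completion of `μ`. -/
def NaivelyHaarNull {G : Type*} [Group G] [MeasurableSpace G] (X : Set G) : Prop :=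
  ∃ μ : Measure G, IsProbabilityMeasure μ ∧ ∀ g h : G, μ (twoSidedTranslate g X h) = 0

open Filter Topology Cardinal

/-- A measurable injection of the Cantor space carries an atomless probability measure. -/
theorem exists_isProbabilityMeasure_of_injective {G : Type*} [TopologicalSpace G] [PolishSpace G]
    [MeasurableSpace G] [BorelSpace G] {f : (ℕ → Bool) → G} (hf : Measurable f)
    (hinj : Function.Injective f) :
    ∃ μ : Measure G, IsProbabilityMeasure μ ∧ ∀ S : Set G, (f ⁻¹' S).Countable → μ S = 0 := by
  have hI : ¬ Countable unitInterval := by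
    intro h
    have h1 : (Set.Icc (0 : ℝ) 1).Countable := Set.countable_coe_iff.mp h
    have h2 : volume (Set.Icc (0 : ℝ) 1) = 0 := h1.measure_zero _
    simp at h2
  let e := PolishSpace.measurableEquivNatBoolOfNotCountable hI
  have hemb : MeasurableEmbedding (f ∘ e) :=
    (hf.measurableEmbedding hinj).comp e.measurableEmbedding
  refine ⟨(volume : Measure unitInterval).map (f ∘ e),
    Measure.isProbabilityMeasure_map hemb.measurable.aemeasurable, fun S hS => ?_⟩
  rw [hemb.map_apply, Set.preimage_comp]
  exact (hS.preimage e.injective).measure_zero _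

/-- An uncountable Borel subset of a Polish space has cardinality continuum. -/
theorem mk_eq_continuum_of_measurableSet {G : Type*} [TopologicalSpace G] [PolishSpace G]
    [MeasurableSpace G] [BorelSpace G] {A : Set G} (hA : MeasurableSet A) (hc : ¬ A.Countable) :
    #A = 𝔠 := by
  have := hA.standardBorel
  have hc' : ¬ Countable A := fun h => hc (Set.countable_coe_iff.mp h)
  have h := Cardinal.mk_congr_lift (PolishSpace.measurableEquivNatBoolOfNotCountable hc').toEquiv
  simpa using h

/-- Transfinite selection: if `R` relates each point to at most one point of each set of the
family, then there is an `R`-independent set meeting every set of the family. -/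
theorem exists_independent_transversal {G : Type*} {S : Set (Set G)} {κ : Cardinal}
    (hS : #S ≤ κ) (hA : ∀ A ∈ S, #A = κ) (R : G → G → Prop)
    (hR : ∀ A ∈ S, ∀ y, {x ∈ A | R y x}.Subsingleton) :
    ∃ X : Set G, (∀ A ∈ S, (X ∩ A).Nonempty) ∧
      ∀ x ∈ X, ∀ y ∈ X, x ≠ y → ¬ R x y ∨ ¬ R y x := by
  classical
  obtain ⟨r, hwo, hr⟩ := Cardinal.exists_ord_eq S
  have hseg (i : S) : #{j : S // r j i} < κ :=
    lt_of_lt_of_le (by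
      have := Ordinal.typein_lt_type r i
      rw [← hr, Cardinal.lt_ord] at this
      exact this) hS
  have key (i : S) (F : {j : S // r j i} → G) : ∃ x ∈ (i : Set G), ∀ j, ¬ R (F j) x := by
    by_contra! hcon
    choose c hc using hcon
    have hinj : Function.Injective fun x : (i : Set G) => c x x.2 := by
      intro x y hxy
      refine Subtype.ext (hR i i.2 (F (c x x.2)) ⟨x.2, hc x x.2⟩ ⟨y.2, ?_⟩)
      have : c x x.2 = c y y.2 := hxy
      rw [this]
      exact hc y y.2
    exact (hA i i.2 ▸ Cardinal.mk_le_of_injective hinj).not_gt (hseg i)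
  choose pick hpick hpick' using key
  let x : S → G := hwo.wf.fix fun i ih => pick i fun j => ih j.1 j.2
  have hx (i : S) : x i = pick i fun j => x j.1 := hwo.wf.fix_eq _ i
  refine ⟨Set.range x, fun A hAS => ⟨x ⟨A, hAS⟩, ⟨_, rfl⟩, ?_⟩, ?_⟩
  · rw [hx]; exact hpick ⟨A, hAS⟩ _
  · rintro _ ⟨i, rfl⟩ _ ⟨j, rfl⟩ hne
    have hlt {i j : S} (h : r i j) : ¬ R (x i) (x j) := by
      rw [hx j]; exact hpick' j (fun k => x k.1) ⟨i, h⟩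
    rcases hwo.trichotomous i j with h
    by_cases h1 : r i j
    · exact Or.inl (hlt h1)
    · by_cases h2 : r j i
      · exact Or.inr (hlt h2)
      · exact absurd (congrArg x (h h1 h2)) hne

/-- One step in the construction of a rapidly converging sequence. -/
theorem exists_next_generator {G : Type*} [CommGroup G] [MetricSpace G] [IsTopologicalGroup G]
    [(𝓝[≠] (1 : G)).NeBot] (F : Finset G) {W : Set G} (hW : W ∈ 𝓝 (1 : G)) {ε : ℝ} (hε : 0 < ε) :
    ∃ g : G, ∃ W' : Set G, g ≠ 1 ∧ W' ∈ 𝓝 (1 : G) ∧ IsClosed W' ∧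
      (∀ p ∈ F, dist p (p * g) ≤ ε) ∧
      ∀ k ∈ Finset.Icc (-2 : ℤ) 2, (∀ w ∈ W', g ^ k * w ∈ W) ∧ (g ^ k ∈ W' → g ^ k = 1) := by
  obtain ⟨V, hV, hVo, hVW⟩ : ∃ V : Set G, V ∈ 𝓝 (1 : G) ∧ IsOpen V ∧
      ∀ v ∈ V, ∀ w ∈ V, v * w ∈ W := by
    obtain ⟨V, hVo, h1, hV⟩ := exists_open_nhds_one_split hW
    exact ⟨V, hVo.mem_nhds h1, hVo, hV⟩
  have h1 : ∀ᶠ g in 𝓝 (1 : G), ∀ p ∈ F, dist p (p * g) ≤ ε := by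
    rw [Filter.eventually_all_finset]
    intro p _
    have : Tendsto (fun g => dist p (p * g)) (𝓝 1) (𝓝 (dist p (p * 1))) :=
      Continuous.tendsto (by fun_prop) 1
    rw [mul_one, dist_self] at this
    exact (this.eventually (gt_mem_nhds hε)).mono fun _ h => h.le
  have h2 : ∀ᶠ g in 𝓝 (1 : G), ∀ k ∈ Finset.Icc (-2 : ℤ) 2, g ^ k ∈ V := by
    rw [Filter.eventually_all_finset]
    intro k _
    have : Tendsto (fun g : G => g ^ k) (𝓝 1) (𝓝 (1 ^ k)) := (continuous_zpow k).tendsto 1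
    rw [one_zpow] at this
    exact this hV
  obtain ⟨g, ⟨hg1, hg2⟩, hg⟩ := (((h1.and h2).filter_mono nhdsWithin_le_nhds).and
    (self_mem_nhdsWithin : {(1 : G)}ᶜ ∈ 𝓝[≠] 1)).exists
  have h3 : ∀ᶠ w in 𝓝 (1 : G), ∀ k ∈ Finset.Icc (-2 : ℤ) 2, w = g ^ k → g ^ k = 1 := by
    rw [Filter.eventually_all_finset]
    intro k _
    by_cases hk : g ^ k = 1
    · simp [hk]
    · filter_upwards [isOpen_ne.mem_nhds (Ne.symm hk)] with w hw h using absurd h hw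
  obtain ⟨W', ⟨hW', hcl⟩, hsub⟩ := (closed_nhds_basis (1 : G)).mem_iff.mp (inter_mem hV h3)
  exact ⟨g, W', hg, hW', hcl, hg1, fun k hk =>
    ⟨fun w hw => hVW _ (hg2 k hk) _ (hsub hw).1, fun h => (hsub h).2 k hk rfl⟩⟩

/-- A sequence of non-identity elements whose subproducts converge, and for which products with
exponents of absolute value at most two converge to `1` only if all factors are trivial. -/
theorem exists_dissociated_seq (G : Type*) [CommGroup G] [TopologicalSpace G]
    [IsTopologicalGroup G] [PolishSpace G] [(𝓝[≠] (1 : G)).NeBot] :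
    ∃ g : ℕ → G, (∀ n, g n ≠ 1) ∧
      (∀ a : ℕ → Bool, ∃ x, Tendsto
        (fun n => ∏ i ∈ Finset.range n, if a i then g i else 1) atTop (𝓝 x)) ∧
      ∀ m : ℕ → ℤ, (∀ i, m i ∈ Finset.Icc (-2 : ℤ) 2) →
        Tendsto (fun n => ∏ i ∈ Finset.range n, g i ^ m i) atTop (𝓝 1) → ∀ i, g i ^ m i = 1 := by
  classical
  let := TopologicalSpace.upgradeIsCompletelyMetrizable G
  choose! nxt nbd h using fun (n : ℕ) (s : Finset G × {W : Set G // W ∈ 𝓝 (1 : G)}) =>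
    exists_next_generator s.1 s.2.2 (pow_pos (one_half_pos (α := ℝ)) n)
  let st : ℕ → Finset G × {W : Set G // W ∈ 𝓝 (1 : G)} := fun n => Nat.rec
    ({1}, ⟨Set.univ, univ_mem⟩)
    (fun n s => (s.1 ∪ s.1.image (· * nxt n s), ⟨nbd n s, (h n s).2.1⟩)) n
  let g : ℕ → G := fun n => nxt n (st n)
  let W : ℕ → Set G := fun n => (st n).2
  have hst (n : ℕ) : (st (n + 1)).1 = (st n).1 ∪ (st n).1.image (· * g n) := rfl
  have hcl (n : ℕ) : IsClosed (W (n + 1)) := (h n (st n)).2.2.1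
  have hdist (n : ℕ) : ∀ p ∈ (st n).1, dist p (p * g n) ≤ (1 / 2) ^ n := (h n (st n)).2.2.2.1
  have hmul (n : ℕ) (k : ℤ) (hk : k ∈ Finset.Icc (-2 : ℤ) 2) (w : G) (hw : w ∈ W (n + 1)) :
      g n ^ k * w ∈ W n := ((h n (st n)).2.2.2.2 k hk).1 w hw
  have hone (n : ℕ) (k : ℤ) (hk : k ∈ Finset.Icc (-2 : ℤ) 2) (hw : g n ^ k ∈ W (n + 1)) :
      g n ^ k = 1 := ((h n (st n)).2.2.2.2 k hk).2 hw
  refine ⟨g, fun n => (h n (st n)).1, fun a => ?_, fun m hm hlim => ?_⟩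
  · have hmem (n : ℕ) : (∏ i ∈ Finset.range n, if a i then g i else 1) ∈ (st n).1 := by
      induction n with
      | zero => simp [st]
      | succ n ih =>
        rw [Finset.prod_range_succ, hst, Finset.mem_union, Finset.mem_image]
        by_cases ha : a n
        · exact Or.inr ⟨_, ih, by simp [ha]⟩
        · exact Or.inl (by simpa [ha] using ih)
    refine cauchySeq_tendsto_of_complete (cauchySeq_of_le_geometric (1 / 2) 1 (by norm_num) ?_)
    intro n
    rw [Finset.prod_range_succ, one_mul]
    by_cases ha : a n
    · simpa [ha] using hdist n _ (hmem n)
    · simp [ha]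
  · have htail (d : ℕ) : ∀ i, ∏ j ∈ Finset.range d, g (i + j) ^ m (i + j) ∈ W i := by
      induction d with
      | zero => intro i; simpa using mem_of_mem_nhds (st i).2.2
      | succ d ih =>
        intro i
        rw [Finset.prod_range_succ', mul_comm]
        refine hmul i _ (hm i) _ ?_
        simpa [add_assoc, add_comm 1] using ih (i + 1)
    intro i
    induction i using Nat.strong_induction_on with
    | _ i ih =>
      have hlim' : Tendsto (fun d => g i ^ (-m i) *
          ∏ j ∈ Finset.range (i + 1 + d), g j ^ m j) atTop (𝓝 (g i ^ (-m i) * 1)) := by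
        refine tendsto_const_nhds.mul (hlim.comp ?_)
        exact tendsto_atTop_mono (fun d => Nat.le_add_left d (i + 1)) tendsto_id
      have hin : g i ^ (-m i) * 1 ∈ W (i + 1) := by
        refine (hcl i).mem_of_tendsto hlim' (Eventually.of_forall fun d => ?_)
        rw [Finset.prod_range_add, Finset.prod_range_succ,
          Finset.prod_eq_one fun j hj => ih j (Finset.mem_range.mp hj), one_mul, ← mul_assoc,
          ← zpow_add, neg_add_cancel, zpow_zero, one_mul]
        exact htail d (i + 1)
      rw [mul_one] at hin
      have hneg : -m i ∈ Finset.Icc (-2 : ℤ) 2 := by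
        have := hm i
        rw [Finset.mem_Icc] at this ⊢
        omega
      simpa using hone i _ hneg hin

/-- Two measurable injections of the Cantor space whose ranges are in mutually generic position. -/
theorem exists_dissociated_cantor_sets (G : Type*) [CommGroup G] [TopologicalSpace G]
    [IsTopologicalGroup G] [PolishSpace G] [MeasurableSpace G] [BorelSpace G]
    [(𝓝[≠] (1 : G)).NeBot] :
    ∃ f k : (ℕ → Bool) → G, Measurable f ∧ Measurable k ∧ Function.Injective f ∧
      ∀ a b c d u v, k a / k b = f c / f d * (f u / f v) → a = b := by
  obtain ⟨g, hg, hconv, hdis⟩ := exists_dissociated_seq G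
  choose Φ hΦ using hconv
  have hmeas : Measurable Φ := by
    refine measurable_of_tendsto_metrizable
      (f := fun n a => ∏ i ∈ Finset.range n, if a i then g i else 1) (fun n => ?_)
      (tendsto_pi_nhds.mpr hΦ)
    refine Finset.measurable_prod _ fun i _ => ?_
    exact Measurable.ite (measurable_pi_apply (X := fun _ : ℕ => Bool) i (MeasurableSet.singleton true))
      measurable_const measurable_const
  have hΦ' (a : ℕ → Bool) : Tendsto
      (fun n => ∏ i ∈ Finset.range n, g i ^ ((a i).toNat : ℤ)) atTop (𝓝 (Φ a)) := by
    refine (hΦ a).congr fun n => Finset.prod_congr rfl fun i _ => ?_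
    cases a i <;> simp
  let E : (ℕ → Bool) → ℕ → Bool := fun a n => decide (n % 2 = 0) && a (n / 2)
  let O : (ℕ → Bool) → ℕ → Bool := fun a n => decide (n % 2 = 1) && a (n / 2)
  have hE : Measurable E := measurable_pi_lambda _ fun n =>
    (measurable_from_top (f := fun b : Bool => decide (n % 2 = 0) && b)).comp
      (measurable_pi_apply (n / 2))
  have hO : Measurable O := measurable_pi_lambda _ fun n =>
    (measurable_from_top (f := fun b : Bool => decide (n % 2 = 1) && b)).comp
      (measurable_pi_apply (n / 2))
  have hpow (n : ℕ) (a b : Bool) (h : g n ^ ((a.toNat : ℤ) - b.toNat) = 1) : a = b := by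
    cases a <;> cases b <;> simp_all
  refine ⟨Φ ∘ E, Φ ∘ O, hmeas.comp hE, hmeas.comp hO, fun a b hab => ?_, ?_⟩
  · have hlim := (hΦ' (E a)).div' (hΦ' (E b))
    rw [show Φ (E a) = Φ (E b) from hab, div_self'] at hlim
    have := hdis (fun i => (E a i).toNat - (E b i).toNat)
      (fun i => by cases E a i <;> cases E b i <;> decide)
      (hlim.congr fun n => by simp only [zpow_sub, Finset.prod_mul_distrib, Finset.prod_inv_distrib,
        div_eq_mul_inv])
    funext n
    simpa [E] using hpow (2 * n) _ _ (this (2 * n))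
  · intro a b c d u v h
    have hlim := ((hΦ' (O a)).div' (hΦ' (O b))).div'
      (((hΦ' (E c)).div' (hΦ' (E d))).mul ((hΦ' (E u)).div' (hΦ' (E v))))
    rw [show Φ (O a) / Φ (O b) = Φ (E c) / Φ (E d) * (Φ (E u) / Φ (E v)) from h,
      div_self'] at hlim
    have := hdis
      (fun i => ((O a i).toNat - (O b i).toNat) -
        (((E c i).toNat - (E d i).toNat) + ((E u i).toNat - (E v i).toNat)))
      (fun i => by
        rcases Nat.mod_two_eq_zero_or_one i with hi | hi
        · simp only [O, E, hi]
          generalize c (i / 2) = c, d (i / 2) = d, u (i / 2) = u, v (i / 2) = v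
          revert c d u v
          simp
        · simp only [O, E, hi]
          generalize a (i / 2) = a, b (i / 2) = b
          revert a b
          simp)
      (hlim.congr fun n => by simp only [zpow_sub, zpow_add, Finset.prod_mul_distrib,
        Finset.prod_inv_distrib, div_eq_mul_inv])
    funext n
    have hn := this (2 * n + 1)
    have h1 : (2 * n + 1) % 2 = 1 := by omega
    have h2 : (2 * n + 1) / 2 = n := by omega
    refine hpow (2 * n + 1) _ _ ?_
    simpa [O, E, h1, h2] using hn

/-- If all translates of a universally measurable set are null, then so is the set with respect
to every convolution with the witnessing measure. -/
theorem UniversallyMeasurable.map_mul_prod_eq_zero {G : Type*} [CommGroup G] [MeasurableSpace G]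
    [MeasurableMul₂ G] {U : Set G} (hU : UniversallyMeasurable U) (μ ν : Measure G)
    [IsProbabilityMeasure μ] [IsProbabilityMeasure ν]
    (h : ∀ g h : G, μ (twoSidedTranslate g U h) = 0) :
    (μ.prod ν).map (fun p => p.1 * p.2) U = 0 := by
  have hm : Measurable fun p : G × G => p.1 * p.2 := measurable_mul
  obtain ⟨B, hBU, hB, hae⟩ := (hU ((μ.prod ν).map fun p => p.1 * p.2)
    (Measure.isProbabilityMeasure_map hm.aemeasurable)).exists_measurable_subset_ae_eq
  rw [← measure_congr hae, Measure.map_apply hm hB, Measure.prod_apply_symm (hm hB)]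
  refine (lintegral_congr fun t => ?_).trans lintegral_zero
  refine measure_mono_null (fun x hx => ?_) (h 1 t⁻¹)
  exact ⟨x * t, hBU hx, by simp⟩

theorem theorem1p3 (G : Type*) [CommGroup G] [TopologicalSpace G] [IsTopologicalGroup G]
    [PolishSpace G] [MeasurableSpace G] [BorelSpace G] [Uncountable G] :
    ∃ X : Set G, NaivelyHaarNull X ∧ ¬ HaarNull X := by
  have hne : (𝓝[≠] (1 : G)).NeBot := by
    by_contra hbot
    rw [not_neBot, ← isOpen_singleton_iff_punctured_nhds] at hbot
    have := discreteTopology_of_isOpen_singleton_one hbot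
    exact not_countable (α := G) (TopologicalSpace.separableSpace_iff_countable.mp inferInstance)
  obtain ⟨f, k, hf, hk, hfi, hfk⟩ := exists_dissociated_cantor_sets G
  have hki : Function.Injective k := fun a b hab =>
    hfk a b a a a a (by simp [hab])
  obtain ⟨μ₀, hμ₀, hμ₀'⟩ := exists_isProbabilityMeasure_of_injective hf hfi
  obtain ⟨ν, hν, hν'⟩ := exists_isProbabilityMeasure_of_injective hk hki
  let S : Set (Set G) :=
    {A | MeasurableSet A ∧ ¬ A.Countable ∧ ∃ s, ∀ x ∈ A, ∃ a, x = s * k a}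
  obtain ⟨X, hXS, hX⟩ := exists_independent_transversal (S := S) (κ := 𝔠)
    (by
      have hle : #{A : Set G | MeasurableSet A} ≤ 𝔠 := by
        obtain ⟨b, hbc, hb⟩ := MeasurableSpace.CountablyGenerated.isCountablyGenerated (α := G)
        rw [hb]
        exact MeasurableSpace.cardinal_measurableSet_le_continuum
          ((Cardinal.le_aleph0_iff_set_countable.mpr hbc).trans aleph0_le_continuum)
      exact (Cardinal.mk_le_mk_of_subset fun A hA => hA.1).trans hle)
    (fun A hA => mk_eq_continuum_of_measurableSet hA.1 hA.2.1)
    (fun y x => ∃ c d, x / y = f c / f d) (by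
      rintro A ⟨-, -, s, hs⟩ y x ⟨hx, c, d, hcd⟩ x' ⟨hx', u, v, huv⟩
      obtain ⟨a, rfl⟩ := hs x hx
      obtain ⟨b, rfl⟩ := hs x' hx'
      rw [hfk a b c d v u]
      rw [← hcd, ← inv_div (f u), ← huv, inv_div, div_mul_div_cancel, mul_div_mul_left_eq_div])
  refine ⟨X, ⟨μ₀, hμ₀, fun g h => hμ₀' _ (Set.Subsingleton.countable ?_)⟩, ?_⟩
  · rintro a ⟨x, hx, hxa⟩ b ⟨y, hy, hyb⟩
    by_contra hab
    have hne : x ≠ y := by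
      rintro rfl
      exact hab (hfi (hxa.symm.trans hyb))
    have hxy : x / y = f a / f b := by rw [← hxa, ← hyb]; simp
    have hyx : y / x = f b / f a := by rw [← hxa, ← hyb]; simp
    exact (hX x hx y hy hne).elim (fun h => h ⟨_, _, hyx⟩) fun h => h ⟨_, _, hxy⟩
  · rintro ⟨U, hXU, hU, μ, hμ, hμU⟩
    have h0 := hU.map_mul_prod_eq_zero μ ν hμU
    obtain ⟨B, hUB, hB, hB0⟩ := exists_measurable_superset_of_null h0
    have hm : Measurable fun p : G × G => p.1 * p.2 := measurable_mul
    rw [Measure.map_apply hm hB, Measure.measure_prod_null (hm hB)] at hB0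
    obtain ⟨s, hs⟩ := hB0.exists
    have hs0 : ν ((fun y => s * y) ⁻¹' B) = 0 := hs
    have hkm : MeasurableSet (Set.range k) := (hk.measurableEmbedding hki).measurableSet_range
    let A : Set G := (fun x => s⁻¹ * x) ⁻¹' Set.range k \ B
    have hAS : A ∈ S := by
      refine ⟨(measurable_const_mul s⁻¹ hkm).diff hB, fun hcount => ?_, s, ?_⟩
      · have h1 : ν ((fun y => s * y) ⁻¹' B)ᶜ = 0 := by
          refine hν' _ ?_
          refine (hcount.preimage (f := fun a => s * k a)
            ((mul_right_injective s).comp hki)).mono fun a ha => ?_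
          exact ⟨by simp, ha⟩
        have h2 := measure_univ_le_add_compl (μ := ν) ((fun y => s * y) ⁻¹' B)
        rw [h1, hs0, measure_univ] at h2
        simp at h2
      · rintro x ⟨⟨a, ha⟩, -⟩
        exact ⟨a, by simp [ha]⟩
    obtain ⟨x, hxX, -, hxB⟩ := hXS A hAS
    exact hxB (hUB (hXU hxX))
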